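/- For an integer $d \ge 1$ let $\mathbf{C}^d$ carry its standard Hermitian inner product, let $\mathrm{U}(\mathbf{C}^d)$ be the group of unitary transformations of $\mathbf{C}^d$, and let $S(\mathbf{C}^d) = \{v \in \mathbf{C}^d : \Vert v \Vert = 1\}$. Let $f_{\mathbf{C}}(d)$ be the smallest real number such that, for every finite group $G \leq \mathrm{U}(\mathbf{C}^d)$ and every $v \in S(\mathbf{C}^d)$, there is some $w \in S(\mathbf{C}^d)$ with $\sup_{g \in G} |\langle gv, w\rangle| \leq f_{\mathbf{C}}(d)$ (such a smallest number exists, by compactness of the sphere). Then for each $d \geq 2$ there is some $\eta_d > 0$ such that $f_{\mathbf{C}}(d) \leq 1 - \eta_d$. -/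

import Mathlib

/-- The group `U(ℂ^d)` of unitary transformations of `ℂ^d` with its standard inner product. -/
abbrev UnitaryTransf (d : ℕ) : Type :=
  EuclideanSpace ℂ (Fin d) ≃ₗᵢ[ℂ] EuclideanSpace ℂ (Fin d)

/-- `c` is an admissible bound in dimension `d` if for every finite group `G ≤ U(ℂ^d)` and every
unit vector `v` there is a unit vector `w` with `sup_{g ∈ G} |⟨g v, w⟩| ≤ c`. -/
def IsWidthBound (d : ℕ) (c : ℝ) : Prop :=
  ∀ G : Subgroup (UnitaryTransf d), Finite G →
    ∀ v : EuclideanSpace ℂ (Fin d), ‖v‖ = 1 →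
      ∃ w : EuclideanSpace ℂ (Fin d), ‖w‖ = 1 ∧
        (⨆ g : G, ‖inner ℂ ((g : UnitaryTransf d) v) w‖) ≤ c

/-- `f_ℂ(d)`: the smallest admissible bound in dimension `d`. For `d ≥ 1` it is a minimum,
see `fC_isLeast`. -/
noncomputable def fC (d : ℕ) : ℝ := sInf {c : ℝ | IsWidthBound d c}

/-- `f_ℂ(d)` is well defined: it is the least admissible bound. -/
theorem fC_isLeast (d : ℕ) (hd : 1 ≤ d) : IsLeast {c : ℝ | IsWidthBound d c} (fC d) := by
  obtain ⟨v₀, hv₀⟩ : ∃ v : EuclideanSpace ℂ (Fin d), ‖v‖ = 1 :=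
    ⟨EuclideanSpace.single ⟨0, hd⟩ 1, by simp⟩
  have hne : {c : ℝ | IsWidthBound d c}.Nonempty := by
    refine ⟨1, fun G _ v hv => ⟨v, hv, ciSup_le fun g => ?_⟩⟩
    refine (norm_inner_le_norm _ _).trans ?_
    rw [LinearIsometryEquiv.norm_map, hv, one_mul]
  have hbdd : BddBelow {c : ℝ | IsWidthBound d c} := by
    refine ⟨0, fun c hc => ?_⟩
    obtain ⟨w, _, h⟩ := hc ⊥ inferInstance v₀ hv₀
    exact (Real.iSup_nonneg fun _ => norm_nonneg _).trans h
  refine ⟨fun G hG v hv => ?_, fun c hc => csInf_le hbdd hc⟩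
  have : Fintype G := Fintype.ofFinite G
  have hcont : Continuous fun w : EuclideanSpace ℂ (Fin d) =>
      ⨆ g : G, ‖inner ℂ ((g : UnitaryTransf d) v) w‖ := by
    simp only [← Finset.sup'_univ_eq_ciSup]
    exact Continuous.finset_sup'_apply _ fun g _ => by fun_prop
  obtain ⟨w, hw, hmin⟩ := (isCompact_sphere (0 : EuclideanSpace ℂ (Fin d)) 1).exists_isMinOn
    ⟨v, by simpa using hv⟩ hcont.continuousOn
  refine ⟨w, by simpa using hw, le_csInf hne fun c hc => ?_⟩
  obtain ⟨w', hw', h⟩ := hc G hG v hv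
  exact (hmin (by simpa using hw' : w' ∈ Metric.sphere (0 : EuclideanSpace ℂ (Fin d)) 1)).trans h

/-!
The theorem rests on a weak form of Jordan's theorem on finite linear groups. If two unitaries
`A`, `B` are close to `1`, their commutator is much closer to `1` than either of them
(`norm_commutator_apply_sub_le`), and if `A` commutes with the commutator of `A` and `B`, then `A`
commutes with `B` (`commute_of_commute_commutator`). In a *finite* group `G` of unitaries this forces
the elements within `1/4` of the identity to commute pairwise (`commute_of_near_one`): take a
counterexample `B` closest to `1` and replace it by its commutator. Commuting operators have a
common eigenvector `e` (`exists_common_eigenvector`), and moving a vector by an element close to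
`1` does not change the modulus of its inner product with `e`. By compactness of the operator unit
ball, `G` is covered by a number `N = N(d)` of translates of its small elements, so that
`|⟨g v, e⟩|` takes at most `N` values as `g` runs over `G`. As `d ≥ 2`, there is a unit vector `w`
for which `|⟨w, e⟩|` is at distance at least `1 / (2 (N + 1))` from all these values, and this
bounds every `|⟨g v, w⟩|` away from `1` (`norm_inner_le_of_orthonormal_pair`).
-/

/-! ### Common eigenvectors -/

/-- A commuting family of operators that stabilizes a nonzero subspace has a common eigenvector in
it: on a nonzero stable subspace of minimal dimension every operator of the family is scalar. -/
theorem exists_common_eigenvector {V : Type*} [AddCommGroup V] [Module ℂ V]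
    [FiniteDimensional ℂ V] (S : Set (Module.End ℂ V)) (hS : ∀ s ∈ S, ∀ t ∈ S, Commute s t)
    (K : Submodule ℂ V) (hK : K ≠ ⊥) (hinv : ∀ s ∈ S, ∀ x ∈ K, s x ∈ K) :
    ∃ v ∈ K, v ≠ 0 ∧ ∀ s ∈ S, ∃ μ : ℂ, s v = μ • v := by
  induction K using WellFoundedLT.induction with
  | ind K ih =>
  by_cases hscal : ∀ s ∈ S, ∃ μ : ℂ, ∀ x ∈ K, s x = μ • x
  · obtain ⟨v, hv, hv0⟩ := K.ne_bot_iff.mp hK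
    refine ⟨v, hv, hv0, fun s hs => ?_⟩
    obtain ⟨μ, hμ⟩ := hscal s hs
    exact ⟨μ, hμ v hv⟩
  · push Not at hscal
    obtain ⟨s, hs, hns⟩ := hscal
    have : Nontrivial K := Submodule.nontrivial_iff_ne_bot.mpr hK
    obtain ⟨μ, hμ⟩ := Module.End.exists_eigenvalue (s.restrict (hinv s hs))
    obtain ⟨x, hx⟩ := hμ.exists_hasEigenvector
    have hxs : s x = μ • (x : V) := congrArg Subtype.val hx.apply_eq_smul
    obtain ⟨y, hyK, hy⟩ := hns μ
    have hlt : K ⊓ Module.End.eigenspace s μ < K := by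
      refine lt_of_le_of_ne inf_le_left fun h => hy ?_
      exact Module.End.mem_eigenspace_iff.mp (inf_eq_left.mp h hyK)
    have hne : K ⊓ Module.End.eigenspace s μ ≠ ⊥ :=
      (Submodule.ne_bot_iff _).mpr
        ⟨x, ⟨x.2, Module.End.mem_eigenspace_iff.mpr hxs⟩, fun h => hx.2 (Subtype.ext h)⟩
    obtain ⟨v, hv, hv'⟩ := ih _ hlt hne fun t ht z hz =>
      ⟨hinv t ht z hz.1, Module.End.mem_eigenspace_iff.mpr (by
        have h1 : s (t z) = t (s z) := LinearMap.congr_fun (hS s hs t ht) z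
        rw [h1, Module.End.mem_eigenspace_iff.mp hz.2, map_smul])⟩
    exact ⟨v, hv.1, hv'⟩

section Unitary

variable {E : Type*} [NormedAddCommGroup E] [InnerProductSpace ℂ E]

theorem linearIsometryEquiv_mul_apply (A B : E ≃ₗᵢ[ℂ] E) (x : E) : (A * B) x = A (B x) := rfl

theorem linearIsometryEquiv_apply_inv (A : E ≃ₗᵢ[ℂ] E) (x : E) : A (A⁻¹ x) = x :=
  A.apply_symm_apply x

theorem linearIsometryEquiv_inv_apply (A : E ≃ₗᵢ[ℂ] E) (x : E) : A⁻¹ (A x) = x :=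
  A.symm_apply_apply x

theorem norm_eq_one_of_map_eq_smul (A : E ≃ₗᵢ[ℂ] E) {v : E} {μ : ℂ} (hv : v ≠ 0)
    (h : A v = μ • v) : ‖μ‖ = 1 := by
  have h1 := A.norm_map v
  rw [h, norm_smul] at h1
  exact mul_right_cancel₀ (norm_ne_zero_iff.mpr hv) (by rw [h1, one_mul])

theorem norm_inner_map_eq_of_map_eq_smul (A : E ≃ₗᵢ[ℂ] E) {e : E} {μ : ℂ} (he : e ≠ 0)
    (h : A e = μ • e) (u : E) : ‖inner ℂ (A u) e‖ = ‖inner ℂ u e‖ := by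
  rw [← A.inner_map_map u e, h, inner_smul_right, norm_mul, norm_eq_one_of_map_eq_smul A he h,
    one_mul]

theorem inner_eq_zero_of_map_eq_smul (A : E ≃ₗᵢ[ℂ] E) {u v : E} {l m : ℂ} (hv : v ≠ 0)
    (hlm : l ≠ m) (hu : A u = l • u) (hv' : A v = m • v) : inner ℂ v u = 0 := by
  have h := A.inner_map_map v u
  rw [hu, hv', inner_smul_left, inner_smul_right] at h
  have hm : starRingEnd ℂ m * m = 1 := by
    rw [Complex.conj_mul', norm_eq_one_of_map_eq_smul A hv hv']; simp
  by_contra h0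
  have h1 : starRingEnd ℂ m * l = 1 := mul_right_cancel₀ h0 (by linear_combination h)
  have hm0 : starRingEnd ℂ m ≠ 0 := left_ne_zero_of_mul_eq_one hm
  exact hlm (mul_left_cancel₀ hm0 (h1.trans hm.symm))

/-! ### Commutators of unitaries near the identity -/

theorem norm_commutator_apply_sub_le (A B : E ≃ₗᵢ[ℂ] E) {a b : ℝ} (ha0 : 0 ≤ a) (hb0 : 0 ≤ b)
    (ha : ∀ x, ‖A x - x‖ ≤ a * ‖x‖) (hb : ∀ x, ‖B x - x‖ ≤ b * ‖x‖) (x : E) :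
    ‖(A * B * A⁻¹ * B⁻¹) x - x‖ ≤ 2 * a * b * ‖x‖ := by
  obtain ⟨y, rfl⟩ : ∃ y, x = B (A y) := ⟨A⁻¹ (B⁻¹ x), by simp only [linearIsometryEquiv_apply_inv]⟩
  have h1 : (A * B * A⁻¹ * B⁻¹) (B (A y)) = A (B y) := by
    simp only [linearIsometryEquiv_mul_apply, linearIsometryEquiv_inv_apply]
  have h2 : A (B y) - B (A y) = (A (B y - y) - (B y - y)) - (B (A y - y) - (A y - y)) := by
    simp only [map_sub]; abel
  rw [h1, h2, LinearIsometryEquiv.norm_map, LinearIsometryEquiv.norm_map]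
  have h3 := (ha (B y - y)).trans (mul_le_mul_of_nonneg_left (hb y) ha0)
  have h4 := (hb (A y - y)).trans (mul_le_mul_of_nonneg_left (ha y) hb0)
  have h5 := norm_sub_le (A (B y - y) - (B y - y)) (B (A y - y) - (A y - y))
  linarith

/-- Frobenius' lemma: if `A` commutes with the commutator `C` of `A` and `B`, where `B` is close
to `1`, then `A` commutes with `B`. Otherwise `A` and `C` have a common eigenvector `v` on which
`C` acts by a scalar other than `1`. As `C * B * A = A * B`, both `v` and `B⁻¹ v` are eigenvectors
of `A`, with distinct eigenvalues, so they are orthogonal. But `B⁻¹ v` is close to `v`. -/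
theorem commute_of_commute_commutator [FiniteDimensional ℂ E] (A B : E ≃ₗᵢ[ℂ] E)
    (hB : ∀ x, ‖B x - x‖ ≤ ‖x‖) (hAC : Commute A (A * B * A⁻¹ * B⁻¹)) : Commute A B := by
  by_contra hAB
  set C : E ≃ₗᵢ[ℂ] E := A * B * A⁻¹ * B⁻¹ with hC
  have hC1 : C ≠ 1 := by
    intro h
    apply hAB
    have : A * B = C * B * A := by rw [hC]; group
    rw [h, one_mul] at this
    exact this
  have hcomm (x : E) : A (C x) = C (A x) := by
    rw [← linearIsometryEquiv_mul_apply, ← linearIsometryEquiv_mul_apply, hAC.eq]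
  let a : Module.End ℂ E := A.toLinearEquiv.toLinearMap
  let c : Module.End ℂ E := C.toLinearEquiv.toLinearMap
  have hac : Commute a c := LinearMap.ext hcomm
  obtain ⟨v, ⟨x, hx⟩, hv0, hv⟩ := exists_common_eigenvector {a, c}
    (by
      rintro s (rfl | rfl) t (rfl | rfl)
      exacts [Commute.refl _, hac, hac.symm, Commute.refl _])
    (LinearMap.range (c - 1))
    (by
      rw [Ne, LinearMap.range_eq_bot, sub_eq_zero]
      exact fun h => hC1 (LinearIsometryEquiv.ext fun x => LinearMap.congr_fun h x))
    (by
      rintro s (rfl | rfl) _ ⟨x, rfl⟩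
      · exact ⟨A x, by simp [a, c, hcomm]⟩
      · exact ⟨C x, by simp [c]⟩)
  obtain ⟨l, hl⟩ : ∃ l : ℂ, A v = l • v := hv a (by simp)
  obtain ⟨m, hm⟩ : ∃ m : ℂ, C v = m • v := hv c (by simp)
  replace hx : C x - x = v := hx
  -- `v` lies in the range of `C - 1`, which for a unitary `C` is orthogonal to the kernel.
  have hm1 : m ≠ 1 := by
    rintro rfl
    rw [one_smul] at hm
    apply hv0
    have h := C.inner_map_map x v
    rw [hm] at h
    rw [← inner_self_eq_zero (𝕜 := ℂ)]
    nth_rewrite 1 [← hx]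
    rw [inner_sub_left, h, sub_self]
  obtain ⟨u, rfl⟩ : ∃ u, v = B u := ⟨B⁻¹ v, by simp only [linearIsometryEquiv_apply_inv]⟩
  have hu0 : u ≠ 0 := fun h => hv0 (by rw [h, map_zero])
  have hl0 : l ≠ 0 := norm_ne_zero_iff.mp (by simp [norm_eq_one_of_map_eq_smul A hv0 hl])
  have hm0 : m ≠ 0 := norm_ne_zero_iff.mp (by simp [norm_eq_one_of_map_eq_smul C hv0 hm])
  have hu : A u = (m⁻¹ * l) • u := by
    apply B.injective
    have h1 : C (B (A u)) = A (B u) := by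
      simp only [hC, linearIsometryEquiv_mul_apply,
      linearIsometryEquiv_inv_apply]
    apply C.injective
    rw [h1, hl, map_smul, map_smul, hm, smul_smul, mul_right_comm, inv_mul_cancel₀ hm0, one_mul]
  have horth := inner_eq_zero_of_map_eq_smul A hv0
    (fun h => hm1 (inv_eq_one.mp (mul_right_cancel₀ hl0 (by rw [h, one_mul])))) hu hl
  have h := hB u
  have h2 : ‖B u - u‖ ^ 2 = ‖u‖ ^ 2 + ‖u‖ ^ 2 := by
    rw [norm_sub_sq (𝕜 := ℂ), horth, LinearIsometryEquiv.norm_map]; simp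
  have h3 : 0 < ‖u‖ := norm_pos_iff.mpr hu0
  nlinarith [norm_nonneg (B u - u)]

/-- In a finite group of unitaries, the elements at distance at most `1/4` from the identity
commute. -/
theorem commute_of_near_one [FiniteDimensional ℂ E] (G : Subgroup (E ≃ₗᵢ[ℂ] E)) [Finite G]
    {A B : E ≃ₗᵢ[ℂ] E} (hA : A ∈ G) (hB : B ∈ G) (hA' : ∀ x, ‖A x - x‖ ≤ 1 / 4 * ‖x‖)
    (hB' : ∀ x, ‖B x - x‖ ≤ 1 / 4 * ‖x‖) : Commute A B := by
  by_contra hAB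
  let δ (g : E ≃ₗᵢ[ℂ] E) : ℝ := ‖(g : E →L[ℂ] E) - 1‖
  have hδ (g : E ≃ₗᵢ[ℂ] E) (x : E) : ‖g x - x‖ ≤ δ g * ‖x‖ :=
    ((g : E →L[ℂ] E) - 1).le_opNorm x
  have hδ' (g : E ≃ₗᵢ[ℂ] E) (r : ℝ) (hr : 0 ≤ r) (h : ∀ x, ‖g x - x‖ ≤ r * ‖x‖) : δ g ≤ r :=
    ContinuousLinearMap.opNorm_le_bound _ hr h
  obtain ⟨D, ⟨hDG, hD', hAD⟩, hmin⟩ := Set.exists_min_image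
    {g : E ≃ₗᵢ[ℂ] E | g ∈ G ∧ δ g ≤ 1 / 4 ∧ ¬ Commute A g} δ
    ((Set.toFinite (G : Set (E ≃ₗᵢ[ℂ] E))).subset fun g hg => hg.1)
    ⟨B, hB, hδ' B _ (by norm_num) hB', hAB⟩
  have hpos : 0 < δ D := by
    refine lt_of_le_of_ne (norm_nonneg _) fun h => hAD ?_
    have : D = 1 := LinearIsometryEquiv.ext fun x => by
      have := hδ D x
      rw [← h, zero_mul] at this
      exact sub_eq_zero.mp (norm_le_zero_iff.mp this)
    exact this ▸ Commute.one_right A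
  have hC : δ (A * D * A⁻¹ * D⁻¹) ≤ 2 * (1 / 4) * δ D :=
    hδ' _ _ (by positivity)
      (norm_commutator_apply_sub_le A D (by norm_num) hpos.le hA' (hδ D))
  apply hAD
  refine commute_of_commute_commutator A D (fun x => (hδ D x).trans ?_) ?_
  · nlinarith [norm_nonneg x]
  · by_contra hAC
    have := hmin _ ⟨G.mul_mem (G.mul_mem (G.mul_mem hA hDG) (G.inv_mem hA)) (G.inv_mem hDG),
      by linarith, hAC⟩
    linarith

/-- The elements of a finite group of unitaries that are near the identity have a common unit
eigenvector `e`, so they preserve the modulus of the inner product with `e`. -/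
theorem exists_norm_inner_eq_of_near_one [FiniteDimensional ℂ E] [Nontrivial E]
    (G : Subgroup (E ≃ₗᵢ[ℂ] E)) [Finite G] :
    ∃ e : E, ‖e‖ = 1 ∧ ∀ A ∈ G, (∀ x, ‖A x - x‖ ≤ 1 / 4 * ‖x‖) →
      ∀ u, ‖inner ℂ (A u) e‖ = ‖inner ℂ u e‖ := by
  obtain ⟨v, -, hv0, hv⟩ := exists_common_eigenvector
    {s : Module.End ℂ E | ∃ A ∈ G, (∀ x, ‖A x - x‖ ≤ 1 / 4 * ‖x‖) ∧
      s = A.toLinearEquiv.toLinearMap}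
    (by
      rintro _ ⟨A, hA, hA', rfl⟩ _ ⟨B, hB, hB', rfl⟩
      exact LinearMap.ext fun x => DFunLike.congr_fun (commute_of_near_one G hA hB hA' hB').eq x)
    ⊤ top_ne_bot (fun _ _ _ _ => Submodule.mem_top)
  refine ⟨((‖v‖⁻¹ : ℝ) : ℂ) • v, ?_, fun A hA hA' u => ?_⟩
  · rw [norm_smul, Complex.norm_real, norm_inv, norm_norm,
      inv_mul_cancel₀ (norm_ne_zero_iff.mpr hv0)]
  · obtain ⟨μ, hμ⟩ : ∃ μ : ℂ, A v = μ • v := hv _ ⟨A, hA, hA', rfl⟩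
    rw [inner_smul_right, inner_smul_right, norm_mul, norm_mul,
      norm_inner_map_eq_of_map_eq_smul A hv0 hμ]

/-! ### Covering the unitary group -/

/-- There is a finite set of operators, independent of any group, that approximates every unitary
to within `1/8`. -/
theorem exists_finset_near_unitary [FiniteDimensional ℂ E] :
    ∃ T : Finset (E →L[ℂ] E), ∀ g : E ≃ₗᵢ[ℂ] E, ∃ c ∈ T, ‖(g : E →L[ℂ] E) - c‖ ≤ 1 / 8 := by
  have : ProperSpace (E →L[ℂ] E) := FiniteDimensional.proper ℂ _
  obtain ⟨T, -, hTf, hT⟩ := finite_cover_balls_of_compact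
    (isCompact_closedBall (0 : E →L[ℂ] E) 1) (show (0 : ℝ) < 1 / 8 by norm_num)
  refine ⟨hTf.toFinset, fun g => ?_⟩
  have hg : (g : E →L[ℂ] E) ∈ Metric.closedBall (0 : E →L[ℂ] E) 1 := by
    rw [mem_closedBall_zero_iff]
    exact ContinuousLinearMap.opNorm_le_bound _ zero_le_one fun x => by simp
  obtain ⟨c, hc, hgc⟩ := Set.mem_iUnion₂.mp (hT hg)
  exact ⟨c, hTf.mem_toFinset.mpr hc, (mem_ball_iff_norm.mp hgc).le⟩

/-- If `e` is as in `exists_norm_inner_eq_of_near_one`, the modulus of the inner product with `e`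
takes on a `G`-orbit at most as many values as there are operators in an approximating set `T`. -/
theorem exists_values_norm_inner (G : Subgroup (E ≃ₗᵢ[ℂ] E)) {T : Finset (E →L[ℂ] E)}
    (hT : ∀ g : E ≃ₗᵢ[ℂ] E, ∃ c ∈ T, ‖(g : E →L[ℂ] E) - c‖ ≤ 1 / 8) {e : E}
    (he : ∀ A ∈ G, (∀ x, ‖A x - x‖ ≤ 1 / 4 * ‖x‖) → ∀ u, ‖inner ℂ (A u) e‖ = ‖inner ℂ u e‖)
    (v : E) :
    ∃ t : (E →L[ℂ] E) → ℝ, ∀ g ∈ G, ∃ c ∈ T, ‖inner ℂ (g v) e‖ = t c := by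
  have hrep (c : E →L[ℂ] E) : ∃ r : ℝ, ∀ g ∈ G, ‖(g : E →L[ℂ] E) - c‖ ≤ 1 / 8 →
      ‖inner ℂ (g v) e‖ = r := by
    by_cases h : ∃ g ∈ G, ‖(g : E →L[ℂ] E) - c‖ ≤ 1 / 8
    · obtain ⟨h, hh, hhc⟩ := h
      refine ⟨‖inner ℂ (h v) e‖, fun g hg hgc => ?_⟩
      have key := he (g * h⁻¹) (G.mul_mem hg (G.inv_mem hh)) (fun x => ?_) (h v)
      · simpa only [linearIsometryEquiv_mul_apply, linearIsometryEquiv_inv_apply] using key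
      · obtain ⟨y, rfl⟩ : ∃ y, x = h y := ⟨h⁻¹ x, by simp only [linearIsometryEquiv_apply_inv]⟩
        have h1 : (g * h⁻¹) (h y) - h y = ((g : E →L[ℂ] E) - c) y - ((h : E →L[ℂ] E) - c) y := by
          simp [linearIsometryEquiv_mul_apply, linearIsometryEquiv_inv_apply]
        rw [h1, LinearIsometryEquiv.norm_map]
        have h2 := ((g : E →L[ℂ] E) - c).le_of_opNorm_le hgc y
        have h3 := ((h : E →L[ℂ] E) - c).le_of_opNorm_le hhc y
        have h4 := norm_sub_le (((g : E →L[ℂ] E) - c) y) (((h : E →L[ℂ] E) - c) y)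
        linarith
    · exact ⟨0, fun g hg hgc => absurd ⟨g, hg, hgc⟩ h⟩
  choose t ht using hrep
  refine ⟨t, fun g hg => ?_⟩
  obtain ⟨c, hc, hgc⟩ := hT g
  exact ⟨c, hc, ht c g hg hgc⟩

/-! ### Avoiding finitely many moduli -/

/-- If `x` and `a • e + b • f` are unit vectors, then `|⟨x, a • e + b • f⟩|` is bounded away from
`1` in terms of the difference of their coordinate moduli along `e`. -/
theorem norm_inner_le_of_orthonormal_pair {e f x : E} (he : ‖e‖ = 1) (hf : ‖f‖ = 1)
    (hef : inner ℂ e f = 0) (hx : ‖x‖ = 1) {a b : ℝ} (ha : 0 ≤ a) (hb : 0 ≤ b)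
    (hab : a ^ 2 + b ^ 2 = 1) :
    ‖inner ℂ x ((a : ℂ) • e + (b : ℂ) • f)‖ ≤ 1 - (a - ‖inner ℂ x e‖) ^ 2 / 2 := by
  have hon : Orthonormal ℂ ![e, f] := by
    rw [orthonormal_vecCons_iff]
    simp [he, hf, hef]
  have hbessel : ‖inner ℂ x e‖ ^ 2 + ‖inner ℂ x f‖ ^ 2 ≤ 1 := by
    have := hon.sum_inner_products_le x (s := Finset.univ)
    simpa [hx, Fin.sum_univ_two, norm_inner_symm x] using this
  have h1 : ‖inner ℂ x ((a : ℂ) • e + (b : ℂ) • f)‖ ≤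
      a * ‖inner ℂ x e‖ + b * ‖inner ℂ x f‖ := by
    rw [inner_add_right, inner_smul_right, inner_smul_right]
    refine (norm_add_le _ _).trans_eq ?_
    rw [norm_mul, norm_mul, Complex.norm_of_nonneg ha, Complex.norm_of_nonneg hb]
  nlinarith [sq_nonneg (b - ‖inner ℂ x f‖)]

end Unitary

/-- Of the `N + 1` points `k / (N + 1)` of `[0, 1]`, one is far from `N` given reals, by the
pigeonhole principle. -/
theorem exists_far_from_finset_values {ι : Type*} (T : Finset ι) (t : ι → ℝ) :
    ∃ a : ℝ, 0 ≤ a ∧ a ≤ 1 ∧ ∀ c ∈ T, 1 / (2 * ((T.card : ℝ) + 1)) ≤ |a - t c| := by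
  by_contra! hcon
  have hN : (0 : ℝ) < (T.card : ℝ) + 1 := by positivity
  have hnear (k : ℕ) (hk : k ∈ Finset.range (T.card + 1)) :
      ∃ c ∈ T, |(k : ℝ) / (T.card + 1) - t c| < 1 / (2 * ((T.card : ℝ) + 1)) := by
    refine hcon _ (by positivity) ((div_le_one hN).mpr ?_)
    exact_mod_cast (Finset.mem_range.mp hk).le
  have : Nonempty ι := ⟨(hnear 0 (by simp)).choose⟩
  choose! φ hφ using hnear
  obtain ⟨j, hj, k, hk, hjk, heq⟩ := Finset.exists_ne_map_eq_of_card_lt_of_maps_to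
    (by simp : T.card < (Finset.range (T.card + 1)).card) 
    (fun k hk => (hφ k hk).1)
  have h1 := (hφ j hj).2
  have h2 := (hφ k hk).2
  rw [heq] at h1
  have h3 : |(j : ℝ) / (T.card + 1) - k / (T.card + 1)| < 1 / ((T.card : ℝ) + 1) := by
    have h4 := abs_sub_le ((j : ℝ) / (T.card + 1)) (t (φ k)) (k / (T.card + 1))
    rw [abs_sub_comm (t (φ k))] at h4
    have h5 : 1 / (2 * ((T.card : ℝ) + 1)) + 1 / (2 * ((T.card : ℝ) + 1)) =
        1 / ((T.card : ℝ) + 1) := by field_simp; norm_num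
    linarith
  rw [← sub_div, abs_div, abs_of_pos hN, div_lt_div_iff_of_pos_right hN] at h3
  have h6 : |(j : ℤ) - k| < 1 := by exact_mod_cast h3
  have := Int.abs_lt_one_iff.mp h6
  omega

theorem proposition1p5 (d : ℕ) (hd : 2 ≤ d) :
    ∃ η : ℝ, 0 < η ∧ fC d ≤ 1 - η := by
  have : Nontrivial (Fin d) := Fin.nontrivial_iff_two_le.mpr hd
  obtain ⟨T, hT⟩ := exists_finset_near_unitary (E := EuclideanSpace ℂ (Fin d))
  refine ⟨(1 / (2 * ((T.card : ℝ) + 1))) ^ 2 / 2, by positivity,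
    (fC_isLeast d (by omega)).2 fun G hG v hv => ?_⟩
  obtain ⟨e, he, hGe⟩ := exists_norm_inner_eq_of_near_one G
  obtain ⟨t, ht⟩ := exists_values_norm_inner G hT hGe v
  obtain ⟨a, ha0, ha1, ha⟩ := exists_far_from_finset_values T t
  obtain ⟨f, hf, hef⟩ : ∃ f : EuclideanSpace ℂ (Fin d), ‖f‖ = 1 ∧ inner ℂ e f = 0 := by
    have hne : (ℂ ∙ e)ᗮ ≠ ⊥ := by
      intro h
      have h1 : (ℂ ∙ e) = ⊤ := Submodule.orthogonal_eq_bot_iff.mp h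
      have h2 := finrank_span_le_card (R := ℂ) ({e} : Set (EuclideanSpace ℂ (Fin d)))
      rw [h1, finrank_top, finrank_euclideanSpace_fin] at h2
      simp at h2
      omega
    obtain ⟨u, hu, hu0⟩ := (Submodule.ne_bot_iff _).mp hne
    refine ⟨((‖u‖⁻¹ : ℝ) : ℂ) • u, ?_, ?_⟩
    · rw [norm_smul, Complex.norm_real, norm_inv, norm_norm,
        inv_mul_cancel₀ (norm_ne_zero_iff.mpr hu0)]
    · rw [inner_smul_right, Submodule.mem_orthogonal_singleton_iff_inner_right.mp hu, mul_zero]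
  have hab : a ^ 2 + √(1 - a ^ 2) ^ 2 = 1 := by
    rw [Real.sq_sqrt (by nlinarith)]; ring
  refine ⟨(a : ℂ) • e + ((√(1 - a ^ 2) : ℝ) : ℂ) • f, ?_, ciSup_le fun g => ?_⟩
  · have h : ‖(a : ℂ) • e + ((√(1 - a ^ 2) : ℝ) : ℂ) • f‖ ^ 2 = 1 := by
      rw [sq, norm_add_sq_eq_norm_sq_add_norm_sq_of_inner_eq_zero _ _
        (by rw [inner_smul_left, inner_smul_right, hef]; simp), norm_smul, norm_smul, he, hf,
        Complex.norm_real, Complex.norm_real, Real.norm_eq_abs, Real.norm_eq_abs, mul_one, mul_one,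
        abs_mul_abs_self, abs_mul_abs_self, ← sq, ← sq, hab]
    exact (pow_eq_one_iff_of_nonneg (norm_nonneg _) two_ne_zero).mp h
  · obtain ⟨c, hc, hgc⟩ := ht g g.2
    refine (norm_inner_le_of_orthonormal_pair he hf hef
      (by rw [LinearIsometryEquiv.norm_map, hv]) ha0 (Real.sqrt_nonneg _) hab).trans ?_
    have h1 := ha c hc
    rw [hgc, ← sq_abs (a - t c)]
    have h2 : (1 / (2 * ((T.card : ℝ) + 1))) ^ 2 ≤ |a - t c| ^ 2 :=
      pow_le_pow_left₀ (by positivity) h1 2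
    linarith
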